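/- Let $X\subset\mathbb{R}^n$ be closed, convex and nonempty, and let $\mathcal{A}\subset\mathbb{R}^n$ be finite and nonempty, such that the functions $x\mapsto e^{\alpha^T x}$, $\alpha\in\mathcal{A}$, are linearly independent on $X$. For $y\in\mathbb{R}^n$ let $\sigma_X(y)=\sup\{y^Tx : x\in X\}\in(-\infty,\infty]$, and for $\nu\in\mathbb{R}^{\mathcal{A}}$ let $\mathcal{A}\nu=\sum_{\alpha\in\mathcal{A}}\nu_\alpha\alpha$. For $\beta\in\mathcal{A}$ put $N_\beta=\{\nu\in\mathbb{R}^{\mathcal{A}} : \nu_\alpha\ge 0 \text{ for all } \alpha\ne\beta,\ \sum_{\alpha}\nu_\alpha=0\}$. A vector $\nu^\star\in N_\beta$ (for some $\beta\in\mathcal{A}$) is an *$X$-circuit* of $\mathcal{A}$ if (1) $\nu^\star\ne 0$; (2) $\sigma_X(-\mathcal{A}\nu^\star)<\infty$; and (3) $\nu^\star$ cannot be written as $\tau\nu^{(1)}+(1-\tau)\nu^{(2)}$ with $0<\tau<1$ and non-proportional $\nu^{(1)},\nu^{(2)}\in N_\beta$ such that $\nu\mapsto\sigma_X(-\mathcal{A}\nu)$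 is linear (that is, finite and affine) on the segment $[\nu^{(1)},\nu^{(2)}]$. An $X$-circuit in $N_\beta$ is *normalized* if its $\beta$-entry equals $-1$. Let $\Lambda_X(\mathcal{A})$ be the set of normalized $X$-circuits, over all $\beta\in\mathcal{A}$. The *functional form* of an $X$-circuit $\nu$ is $\phi_\nu=(\nu,\sigma_X(-\mathcal{A}\nu))\in\mathbb{R}^{\mathcal{A}}\times\mathbb{R}$. For a set $S$, let $\operatorname{cone}(S)$ be the set formed by adjoining the origin to the smallest convex cone containing $S$ (a cone being a set closed under multiplication by positive scalars). The *circuit graph* is $$G_X(\mathcal{A})=\operatorname{cone}\big(\{\phi_\lambda : \lambda\in\Lambda_X(\mathcal{A})\}\cup\{(\mathbf 0,1)\}\big)\subset\mathbb{R}^{\mathcal{A}}\times\mathbb{R}.$$ Let $\Lambda_X^\star(\mathcal{A})$, the set of *normalized reduced $X$-circuits*, consist of those $\lambda\in\Lambda_X(\mathcal{A})$ for which $\{t\phi_\lambda : t\ge 0\}$ is an extreme ray (a one-dimensional face) of $G_X(\mathcal{A})$. **Theorem.** The circuit graph $G_X(\mathcal{A})$ is closed and pointed (it contains no lines), and it is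 generated by the functional forms of the normalized reduced $X$-circuits together with $(\mathbf 0,1)$: $$G_X(\mathcal{A})=\operatorname{cone}\big(\{\phi_\lambda : \lambda\in\Lambda_X^\star(\mathcal{A})\}\cup\{(\mathbf 0,1)\}\big).$$ -/

import Mathlib

noncomputable section

open scoped InnerProductSpace

namespace SublinearCircuit

/-- A set contains no lines. A convex cone is called *pointed* when it has this property. -/
def ContainsNoLines {V : Type*} [AddCommGroup V] [Module ℝ V] (K : Set V) : Prop :=
  ∀ p v : V, v ≠ 0 → ¬ ∀ t : ℝ, p + t • v ∈ K

/-- The conic hull of `S`: the origin together with the smallest convex cone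
(set closed under addition and positive dilation) that contains `S`. -/
def conicHull {V : Type*} [AddCommGroup V] [Module ℝ V] (S : Set V) : Set V :=
  insert 0 (ConvexCone.hull ℝ S : Set V)

/-- `F` is a face of the convex set `K`: a closed convex subset that contains every segment of `K`
whose relative interior meets `F`. -/
def IsFace {V : Type*} [AddCommGroup V] [Module ℝ V] [TopologicalSpace V] (K F : Set V) : Prop :=
  IsClosed F ∧ Convex ℝ F ∧ IsExtreme ℝ K F

/-- `v` is an edge generator of the convex cone `K`: the ray `{t v : t ≥ 0}` is an extreme ray of
`K`, that is, a face of dimension one. -/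
def IsEdgeGenerator {V : Type*} [AddCommGroup V] [Module ℝ V] [TopologicalSpace V]
    (K : Set V) (v : V) : Prop :=
  IsFace K {w | ∃ t : ℝ, 0 ≤ t ∧ w = t • v} ∧
    Module.finrank ℝ (vectorSpan ℝ {w : V | ∃ t : ℝ, 0 ≤ t ∧ w = t • v}) = 1

variable {n : ℕ}

/-- The support function `σ_X(y) = sup {yᵀx : x ∈ X}`, with values in `[-∞, ∞]`. -/
def supportFn (X : Set (EuclideanSpace ℝ (Fin n))) (y : EuclideanSpace ℝ (Fin n)) : EReal :=
  ⨆ x ∈ X, ((⟪y, x⟫_ℝ : ℝ) : EReal)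

/-- The linear operator `ν ↦ 𝒜 ν = ∑ α, ν_α α`. -/
def applyOp (A : Finset (EuclideanSpace ℝ (Fin n))) (ν : A → ℝ) : EuclideanSpace ℝ (Fin n) :=
  ∑ α : A, ν α • (α : EuclideanSpace ℝ (Fin n))

/-- The augmented support function `ν ↦ σ_X(-𝒜 ν)`. -/
def augSupport (X : Set (EuclideanSpace ℝ (Fin n))) (A : Finset (EuclideanSpace ℝ (Fin n)))
    (ν : A → ℝ) : EReal :=
  supportFn X (-applyOp A ν)

/-- The cone `N_β` of vectors that sum to zero and are nonnegative away from `β`. -/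
def coneN (A : Finset (EuclideanSpace ℝ (Fin n))) (β : A) : Set (A → ℝ) :=
  {ν | (∀ α, α ≠ β → 0 ≤ ν α) ∧ ∑ α, ν α = 0}

/-- `ν ↦ σ_X(-𝒜 ν)` is linear (finite and affine) on the segment `[ν₁, ν₂]`. -/
def LinearOnSegment (X : Set (EuclideanSpace ℝ (Fin n)))
    (A : Finset (EuclideanSpace ℝ (Fin n))) (ν₁ ν₂ : A → ℝ) : Prop :=
  augSupport X A ν₁ < ⊤ ∧ augSupport X A ν₂ < ⊤ ∧
    ∀ s t : ℝ, 0 ≤ s → 0 ≤ t → s + t = 1 →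
      augSupport X A (s • ν₁ + t • ν₂) =
        (s : EReal) * augSupport X A ν₁ + (t : EReal) * augSupport X A ν₂

/-- `ν ∈ N_β` is an `X`-circuit of `A`: it is nonzero, `σ_X(-𝒜 ν) < ∞`, and it is not a proper
convex combination of two non-proportional elements of `N_β` between which `ν ↦ σ_X(-𝒜 ν)` is
linear. -/
def IsCircuitAt (X : Set (EuclideanSpace ℝ (Fin n))) (A : Finset (EuclideanSpace ℝ (Fin n)))
    (β : A) (ν : A → ℝ) : Prop :=
  ν ∈ coneN A β ∧ ν ≠ 0 ∧ augSupport X A ν < ⊤ ∧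
    ¬ ∃ ν₁ ∈ coneN A β, ∃ ν₂ ∈ coneN A β,
      LinearIndependent ℝ ![ν₁, ν₂] ∧ ν ∈ openSegment ℝ ν₁ ν₂ ∧ LinearOnSegment X A ν₁ ν₂

/-- The set `Λ_X(A)` of normalized `X`-circuits (over all `β ∈ A`). -/
def normalizedCircuits (X : Set (EuclideanSpace ℝ (Fin n)))
    (A : Finset (EuclideanSpace ℝ (Fin n))) : Set (A → ℝ) :=
  {ν | ∃ β : A, IsCircuitAt X A β ν ∧ ν β = -1}

/-- The functional form `φ_ν = (ν, σ_X(-𝒜 ν))` of an `X`-circuit `ν`, as a vector in `ℝ^A × ℝ`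
(`σ_X(-𝒜 ν)` is finite for every circuit). -/
def functionalForm (X : Set (EuclideanSpace ℝ (Fin n)))
    (A : Finset (EuclideanSpace ℝ (Fin n))) (ν : A → ℝ) : (A → ℝ) × ℝ :=
  (ν, (augSupport X A ν).toReal)

/-- The circuit graph `G_X(A)`. -/
def circuitGraph (X : Set (EuclideanSpace ℝ (Fin n)))
    (A : Finset (EuclideanSpace ℝ (Fin n))) : Set ((A → ℝ) × ℝ) :=
  conicHull (functionalForm X A '' normalizedCircuits X A ∪ {(0, 1)})

/-- `ν` is a reduced `X`-circuit: `ν / ‖ν‖_∞` is a normalized circuit and `φ_ν` generates an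
extreme ray of the circuit graph. (The norm of `A → ℝ` is the maximum norm.) -/
def IsReducedCircuit (X : Set (EuclideanSpace ℝ (Fin n)))
    (A : Finset (EuclideanSpace ℝ (Fin n))) (ν : A → ℝ) : Prop :=
  ‖ν‖⁻¹ • ν ∈ normalizedCircuits X A ∧
    IsEdgeGenerator (circuitGraph X A) (functionalForm X A ν)

/-- The set `Λ*_X(A)` of normalized reduced `X`-circuits. -/
def reducedCircuits (X : Set (EuclideanSpace ℝ (Fin n)))
    (A : Finset (EuclideanSpace ℝ (Fin n))) : Set (A → ℝ) :=
  {ν | ν ∈ normalizedCircuits X A ∧ IsReducedCircuit X A ν}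

end SublinearCircuit

end

open SublinearCircuit

/-!
For each `β ∈ A`, the epigraph of the sublinear function `ν ↦ σ_X(-𝒜 ν)` over `N_β` is a closed
convex cone without lines, because `N_β` has none. By Minkowski's theorem for cones
(`mem_hull_isExtremeVector`) it is generated by its extreme rays, and these are spanned by `(0, 1)`
and by functional forms of normalized circuits (`epigraph_extreme_cases`). Hence the circuit graph
is the Minkowski sum of the epigraphs (`hull_normalizedCircuits_eq_iSup`).

The sum is closed and without lines because the epigraphs are positively independent: elements of
them that add up to zero all vanish (`eq_zero_of_sum_epigraph_eq_zero`). This follows from a strict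
Jensen inequality for the square of the norm, once it is known that distinct points of `A` stay
distinct after projection to the span of `X - X`. The latter is where linear independence of the
exponentials enters, and only for pairs (`not_constant_of_linearIndependent`).

Minkowski's theorem, applied now to the circuit graph, shows that its extreme rays generate it. Each
of them is spanned by a generator, which is `(0, 1)` or the functional form of a circuit that is
then reduced by definition.
-/

namespace SublinearCircuit

open Filter Topology

section Cones

/-! ### Closed cones without lines and their extreme rays -/

variable {E V : Type*} [NormedAddCommGroup E] [NormedSpace ℝ E] [NormedAddCommGroup V]
  [NormedSpace ℝ V]

/-- A linear map whose kernel meets a closed cone only in the origin is bounded below on that cone,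
hence maps it to a closed set. -/
theorem isClosed_image_of_ker_trivial [FiniteDimensional ℝ E] {C : Set E} (hC : IsClosed C)
    (hsmul : ∀ r : ℝ, 0 < r → ∀ x ∈ C, r • x ∈ C) (L : E →L[ℝ] V)
    (hker : ∀ x ∈ C, L x = 0 → x = 0) : IsClosed (L '' C) := by
  have : ProperSpace E := FiniteDimensional.proper ℝ E
  obtain ⟨c, hc, hbound⟩ : ∃ c : ℝ, 0 < c ∧ ∀ x ∈ C, c * ‖x‖ ≤ ‖L x‖ := by
    have hscale : ∀ x ∈ C, x ≠ 0 → ‖x‖⁻¹ • x ∈ C ∩ Metric.sphere 0 1 := fun x hx h0 =>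
      ⟨hsmul _ (by positivity) x hx, by
        have : ‖x‖ ≠ 0 := norm_ne_zero_iff.2 h0
        simp [norm_smul, this]⟩
    have hK : IsCompact (C ∩ Metric.sphere (0 : E) 1) := (isCompact_sphere 0 1).inter_left hC
    by_cases hne : (C ∩ Metric.sphere (0 : E) 1).Nonempty
    · obtain ⟨z, hz, hmin⟩ := hK.exists_isMinOn hne (f := fun x => ‖L x‖) (by fun_prop)
      have hz0 : z ≠ 0 := by
        rintro rfl
        simpa using hz.2
      refine ⟨‖L z‖, norm_pos_iff.2 fun h => hz0 (hker z hz.1 h), fun x hx => ?_⟩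
      by_cases h0 : x = 0
      · simp [h0]
      have := hmin (hscale x hx h0)
      simp only [Set.mem_ofPred_eq, map_smul, norm_smul, norm_inv, norm_norm] at this
      rwa [inv_mul_eq_div, le_div_iff₀ (norm_pos_iff.2 h0)] at this
    · refine ⟨1, one_pos, fun x hx => ?_⟩
      have h0 : x = 0 := by
        by_contra h0
        exact hne ⟨_, hscale x hx h0⟩
      simp [h0]
  refine isClosed_of_closure_subset fun y hy => ?_
  have hsub : Metric.ball y 1 ∩ L '' C ⊆ L '' (C ∩ Metric.closedBall 0 ((‖y‖ + 1) / c)) := by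
    rintro _ ⟨hb, x, hx, rfl⟩
    refine ⟨x, ⟨hx, ?_⟩, rfl⟩
    rw [mem_closedBall_zero_iff, le_div_iff₀ hc, mul_comm]
    have h1 : ‖L x - y‖ < 1 := by rwa [← dist_eq_norm]
    have h2 := norm_sub_norm_le (L x) y
    linarith [hbound x hx]
  have hcpt : IsCompact (L '' (C ∩ Metric.closedBall 0 ((‖y‖ + 1) / c))) :=
    ((isCompact_closedBall 0 _).inter_left hC).image L.continuous
  have hy' := Metric.isOpen_ball.inter_closure ⟨Metric.mem_ball_self (x := y) one_pos, hy⟩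
  obtain ⟨x, hx, rfl⟩ := closure_minimal hsub hcpt.isClosed hy'
  exact ⟨x, hx.1, rfl⟩

/-- The nonzero vector `x` spans an extreme ray of the cone `C`: all summands of `x` in `C` are
nonnegative multiples of `x`. -/
def IsExtremeVector (C : PointedCone ℝ V) (x : V) : Prop :=
  x ∈ C ∧ x ≠ 0 ∧ ∀ a ∈ C, ∀ b ∈ C, a + b = x → ∃ r : ℝ, 0 ≤ r ∧ a = r • x

/-- The face of `C` generated by `x ∈ C`: the vectors of `C` some positive multiple of which can be
subtracted from `x` without leaving `C`. -/
def dominatedCone (C : PointedCone ℝ V) (x : V) (hx : x ∈ C) : PointedCone ℝ V where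
  carrier := {y | y ∈ C ∧ ∃ ε : ℝ, 0 < ε ∧ x - ε • y ∈ C}
  zero_mem' := ⟨C.zero_mem, 1, one_pos, by simpa using hx⟩
  add_mem' := by
    rintro a b ⟨ha, ε, hε, hxa⟩ ⟨hb, δ, hδ, hxb⟩
    refine ⟨C.add_mem ha hb, ε * δ / (ε + δ), by positivity, ?_⟩
    have h := C.add_mem (PointedCone.smul_mem C (r := δ / (ε + δ)) (by positivity) hxa)
      (PointedCone.smul_mem C (r := ε / (ε + δ)) (by positivity) hxb)
    convert h using 1
    have hs : ε + δ ≠ 0 := by positivity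
    match_scalars <;> field_simp
    ring
  smul_mem' := by
    rintro ⟨r, hr⟩ a ⟨ha, ε, hε, hxa⟩
    refine ⟨C.smul_mem hr ha, ε / (r + 1), by positivity, ?_⟩
    have h := C.add_mem (PointedCone.smul_mem C (r := r / (r + 1)) (by positivity) hxa)
      (PointedCone.smul_mem C (r := 1 / (r + 1)) (by positivity) hx)
    convert h using 1
    change x - (ε / (r + 1)) • (r • a) = _
    match_scalars <;> field_simp

variable {C : PointedCone ℝ V}

theorem mem_dominatedCone {x y : V} {hx : x ∈ C} :
    y ∈ dominatedCone C x hx ↔ y ∈ C ∧ ∃ ε : ℝ, 0 < ε ∧ x - ε • y ∈ C := Iff.rfl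

theorem exists_sub_of_mem_span (F : PointedCone ℝ V) {y : V}
    (hy : y ∈ Submodule.span ℝ (F : Set V)) : ∃ a ∈ F, ∃ b ∈ F, y = a - b := by
  induction hy using Submodule.span_induction with
  | mem x h => exact ⟨x, h, 0, F.zero_mem, by simp⟩
  | zero => exact ⟨0, F.zero_mem, 0, F.zero_mem, by simp⟩
  | add x y _ _ hx hy =>
    obtain ⟨a, ha, b, hb, rfl⟩ := hx
    obtain ⟨c, hc, d, hd, rfl⟩ := hy
    exact ⟨a + c, F.add_mem ha hc, b + d, F.add_mem hb hd, by abel⟩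
  | smul r x _ hx =>
    obtain ⟨a, ha, b, hb, rfl⟩ := hx
    rcases le_total 0 r with hr | hr
    · exact ⟨r • a, F.smul_mem hr ha, r • b, F.smul_mem hr hb, smul_sub _ _ _⟩
    · exact ⟨(-r) • b, F.smul_mem (neg_nonneg.2 hr) hb, (-r) • a,
        F.smul_mem (neg_nonneg.2 hr) ha, by module⟩

/-- In a closed cone without lines, a ray in the direction `-y` leaves the cone at a last point. -/
theorem exists_max_sub_smul_mem (hC : IsClosed (C : Set V))
    (hs : ∀ v ∈ C, -v ∈ C → v = 0) {x y : V} (hx : x ∈ C) (hy : y ∈ C) (hy0 : y ≠ 0) :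
    ∃ t : ℝ, 0 ≤ t ∧ x - t • y ∈ C ∧ ∀ ε : ℝ, 0 < ε → x - t • y - ε • y ∉ C := by
  set T : Set ℝ := {t | 0 ≤ t ∧ x - t • y ∈ C}
  have hT : IsClosed T := isClosed_Ici.inter
    (hC.preimage (by fun_prop : Continuous fun t : ℝ => x - t • y))
  have hbdd : BddAbove T := by
    -- Otherwise `-y` is the limit of the vectors `t⁻¹ • x - y ∈ C` as `t → ∞`.
    by_contra hb
    rw [not_bddAbove_iff] at hb
    choose t ht hlt using fun n : ℕ => hb n
    have hlim : Tendsto (fun n => (t n)⁻¹ • x - y) atTop (𝓝 ((0 : ℝ) • x - y)) :=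
      ((tendsto_inv_atTop_zero.comp (tendsto_atTop_mono (fun n => (hlt n).le)
        tendsto_natCast_atTop_atTop)).smul_const x).sub_const y
    refine hy0 (hs y hy ?_)
    rw [zero_smul, zero_sub] at hlim
    refine hC.mem_of_tendsto hlim (Eventually.of_forall fun n => ?_)
    have hpos : 0 < t n := (Nat.cast_nonneg n).trans_lt (hlt n)
    have := C.smul_mem (r := (t n)⁻¹) (by positivity) (ht n).2
    rwa [smul_sub, inv_smul_smul₀ hpos.ne'] at this
  have hmem : sSup T ∈ T := hT.csSup_mem ⟨0, le_rfl, by simpa using hx⟩ hbdd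
  refine ⟨sSup T, hmem.1, hmem.2, fun ε hε h => ?_⟩
  have : sSup T + ε ∈ T := ⟨by linarith [hmem.1], by rwa [add_smul, ← sub_sub]⟩
  linarith [le_csSup hbdd this]

/-- Moving from `x` in a direction `-y`, where `y` lies in the face generated by `x`, up to the
last point in `C` strictly lowers the dimension of the generated face. -/
theorem span_dominatedCone_lt {x y z : V} (hx : x ∈ C) (hz : z ∈ C) {t : ℝ} (ht : 0 ≤ t)
    (hzx : z = x - t • y) (hy : y ∈ dominatedCone C x hx)
    (hmax : ∀ ε : ℝ, 0 < ε → z - ε • y ∉ C) :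
    Submodule.span ℝ (dominatedCone C z hz : Set V) <
      Submodule.span ℝ (dominatedCone C x hx : Set V) := by
  refine lt_of_le_of_ne (Submodule.span_mono ?_) fun heq => ?_
  · rintro w ⟨hw, ε, hε, hzw⟩
    refine ⟨hw, ε, hε, ?_⟩
    have := C.add_mem hzw (C.smul_mem ht hy.1)
    rwa [hzx, sub_right_comm, sub_add_cancel] at this
  · -- Equal spans give `y = a - b` with `a`, `b` in the face of `z`, so that `z - ε • y`
    -- is `(z - ε • a) + ε • b ∈ C` for a small `ε`, against the choice of `z`.
    obtain ⟨a, ⟨-, ε, hε, ha⟩, b, hb, hab⟩ :=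
      exists_sub_of_mem_span _ (heq ▸ Submodule.subset_span hy)
    refine hmax ε hε ?_
    have := C.add_mem ha (C.smul_mem hε.le hb.1)
    convert this using 1
    rw [hab]
    module

/-- Minkowski's theorem for cones. A vector `x` which is not extreme lies on a segment between two
vectors that generate faces of smaller dimension, so that induction on this dimension applies. -/
theorem mem_hull_isExtremeVector [FiniteDimensional ℝ V] (hC : IsClosed (C : Set V))
    (hs : ∀ v ∈ C, -v ∈ C → v = 0) {x : V} (hx : x ∈ C) :
    x ∈ PointedCone.hull ℝ {v | IsExtremeVector C v} := by
  induction hd : Module.finrank ℝ (Submodule.span ℝ (dominatedCone C x hx : Set V)) using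
    Nat.strong_induction_on generalizing x with
  | _ d ih =>
  subst hd
  by_cases hx0 : x = 0
  · exact hx0 ▸ Submodule.zero_mem _
  by_cases hext : IsExtremeVector C x
  · exact Submodule.subset_span hext
  obtain ⟨y, hy, hyx⟩ : ∃ y ∈ dominatedCone C x hx, ∀ r : ℝ, y ≠ r • x := by
    by_contra! hall
    refine hext ⟨hx, hx0, fun a ha b hb hab => ?_⟩
    obtain ⟨r, hr⟩ := hall a ⟨ha, 1, one_pos, by rwa [one_smul, ← hab, add_sub_cancel_left]⟩
    refine ⟨r, ?_, hr⟩
    by_contra! hneg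
    refine hx0 (hs x hx ?_)
    have := C.smul_mem (r := (-r)⁻¹) (inv_nonneg.2 (by linarith)) ha
    rwa [hr, smul_smul, inv_neg, neg_mul, inv_mul_cancel₀ hneg.ne, neg_one_smul] at this
  -- The step is used twice: from `x` against `y` to a point `z`, then from `x` against `z` to a
  -- point `w`. Then `x = w + s • z`, where `z` and `w` generate smaller faces.
  have hstep : ∀ y, y ∈ dominatedCone C x hx → y ≠ 0 → ∃ t : ℝ, 0 ≤ t ∧ x - t • y ∈ C ∧
      x - t • y ∈ PointedCone.hull ℝ {v | IsExtremeVector C v} := by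
    intro y hy hy0
    obtain ⟨t, ht, hmem, hmax⟩ := exists_max_sub_smul_mem hC hs hx hy.1 hy0
    exact ⟨t, ht, hmem, ih _ (Submodule.finrank_lt_finrank_of_lt
      (span_dominatedCone_lt hx hmem ht rfl hy hmax)) hmem rfl⟩
  obtain ⟨t, ht, hzC, hz⟩ := hstep y hy fun h => hyx 0 (by simpa using h)
  have hz0 : x - t • y ≠ 0 := fun h => by
    have ht0 : t ≠ 0 := by
      rintro rfl
      exact hx0 (by simpa using h)
    exact hyx t⁻¹ (by rw [sub_eq_zero.1 h, inv_smul_smul₀ ht0])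
  obtain ⟨s, hs0, -, hw⟩ := hstep (x - t • y)
    ⟨hzC, 1, one_pos, by simpa using C.smul_mem ht hy.1⟩ hz0
  have := Submodule.add_mem _ hw (PointedCone.smul_mem _ hs0 hz)
  rwa [sub_add_cancel] at this

/-- An extreme ray of the cone generated by `S` is spanned by an element of
`S`. -/
theorem IsExtremeVector.exists_generator {S : Set V} (hS : (0 : V) ∉ S) {x : V}
    (hx : IsExtremeVector (PointedCone.hull ℝ S) x) : ∃ s ∈ S, ∃ r : ℝ, 0 < r ∧ s = r • x := by
  have key : ∀ y ∈ PointedCone.hull ℝ S, y ≠ 0 → ∃ s ∈ S, ∃ c : ℝ, 0 < c ∧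
      ∃ b ∈ PointedCone.hull ℝ S, y = c • s + b := by
    intro y hy
    induction hy using Submodule.span_induction with
    | mem s h => exact fun _ => ⟨s, h, 1, one_pos, 0, Submodule.zero_mem _, by simp⟩
    | zero => exact fun h => absurd rfl h
    | add u v hu hv ihu ihv =>
      intro h
      by_cases hu0 : u = 0
      · have hv0 : v ≠ 0 := fun hv0 => h (by simp [hu0, hv0])
        simpa [hu0] using ihv hv0
      · obtain ⟨s, hs, c, hc, b, hb, rfl⟩ := ihu hu0
        exact ⟨s, hs, c, hc, b + v, Submodule.add_mem _ hb hv, add_assoc _ _ _⟩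
    | smul r u hu ihu =>
      intro h
      have hr0 : (r : ℝ) ≠ 0 := fun hr => h (by
        change (r : ℝ) • u = 0
        simp [hr])
      obtain ⟨s, hs, c, hc, b, hb, rfl⟩ := ihu (fun hu0 => h (by simp [hu0]))
      refine ⟨s, hs, r * c, mul_pos (lt_of_le_of_ne r.2 hr0.symm) hc, r • b,
        Submodule.smul_mem _ r hb, ?_⟩
      change (r : ℝ) • _ = _ + (r : ℝ) • b
      rw [smul_add, smul_smul]
  obtain ⟨hxC, hx0, hext⟩ := hx
  obtain ⟨s, hs, c, hc, b, hb, hsb⟩ := key x hxC hx0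
  obtain ⟨r, hr, h⟩ := hext (c • s) (PointedCone.smul_mem _ hc.le (Submodule.subset_span hs)) b hb
    hsb.symm
  have hsx : s = (c⁻¹ * r) • x := by rw [mul_smul, ← h, inv_smul_smul₀ hc.ne']
  refine ⟨s, hs, _, lt_of_le_of_ne (by positivity) fun h0 => hS ?_, hsx⟩
  rw [← h0, zero_smul] at hsx
  exact hsx ▸ hs

theorem IsExtremeVector.smul {x : V} (hx : IsExtremeVector C x) {c : ℝ} (hc : 0 < c) :
    IsExtremeVector C (c • x) := by
  obtain ⟨hxC, hx0, hext⟩ := hx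
  refine ⟨C.smul_mem hc.le hxC, smul_ne_zero hc.ne' hx0, fun a ha b hb hab => ?_⟩
  obtain ⟨r, hr, h⟩ := hext _ (C.smul_mem (inv_nonneg.2 hc.le) ha) _
    (C.smul_mem (inv_nonneg.2 hc.le) hb) (by rw [← smul_add, hab, inv_smul_smul₀ hc.ne'])
  refine ⟨r, hr, ?_⟩
  rw [smul_comm, ← h, smul_inv_smul₀ hc.ne']

theorem IsExtremeVector.isEdgeGenerator (hs : ∀ v ∈ C, -v ∈ C → v = 0) {x : V}
    (hx : IsExtremeVector C x) : IsEdgeGenerator (C : Set V) x := by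
  have hx0 := hx.2.1
  have hray : {w : V | ∃ t : ℝ, 0 ≤ t ∧ w = t • x} = (fun t : ℝ => t • x) '' Set.Ici 0 := by
    ext w
    simp [eq_comm]
  refine ⟨⟨?_, ?_, ?_, ?_⟩, ?_⟩
  · rw [hray]
    exact (isClosedEmbedding_smul_left hx0).isClosedMap _ isClosed_Ici
  · rw [hray]
    exact (convex_Ici 0).is_linear_image (LinearMap.toSpanSingleton ℝ V x).isLinear
  · rintro _ ⟨t, ht, rfl⟩
    exact C.smul_mem ht hx.1
  · rintro a ha b hb _ ⟨t, ht, rfl⟩ ⟨p, q, hp, hq, -, hpq⟩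
    suffices h : ∃ r : ℝ, 0 ≤ r ∧ p • a = r • x by
      obtain ⟨r, hr, h⟩ := h
      exact ⟨p⁻¹ * r, by positivity, by rw [mul_smul, ← h, inv_smul_smul₀ hp.ne']⟩
    have hpa := C.smul_mem hp.le ha
    have hqb := C.smul_mem hq.le hb
    -- The apex `t = 0` of the ray is extreme because `C` has no lines.
    rcases ht.eq_or_lt with rfl | ht
    · refine ⟨0, le_rfl, ?_⟩
      rw [zero_smul] at hpq ⊢
      exact hs _ hpa (by rwa [neg_eq_of_add_eq_zero_right hpq])
    · obtain ⟨r, hr, h⟩ := (hx.smul ht).2.2 _ hpa _ hqb hpq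
      exact ⟨r * t, by positivity, by rw [h, smul_smul]⟩
  · have hspan : vectorSpan ℝ {w : V | ∃ t : ℝ, 0 ≤ t ∧ w = t • x} = ℝ ∙ x := by
      rw [vectorSpan_eq_span_vsub_set_right ℝ (p := (0 : V)) (Exists.intro 0 ⟨le_rfl, by simp⟩)]
      simp only [vsub_eq_sub, sub_zero, Set.image_id']
      refine le_antisymm (Submodule.span_le.2 ?_) ((Submodule.span_singleton_le_iff_mem _ _).2
        (Submodule.subset_span ⟨1, zero_le_one, by simp⟩))
      rintro _ ⟨t, -, rfl⟩
      exact Submodule.smul_mem _ _ (Submodule.mem_span_singleton_self x)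
    rw [hspan, finrank_span_singleton hx0]

theorem conicHull_eq_hull (S : Set V) : conicHull S = (PointedCone.hull ℝ S : Set V) := by
  refine Set.Subset.antisymm (Set.insert_subset (Submodule.zero_mem _) ?_) fun x hx => ?_
  · exact ConvexCone.hull_min (C := (PointedCone.hull ℝ S).toConvexCone) Submodule.subset_span
  · induction hx using Submodule.span_induction with
    | mem s h => exact Or.inr (ConvexCone.subset_hull h)
    | zero => exact Or.inl rfl
    | add u v _ _ hu hv =>
      rcases hu with rfl | hu
      · rwa [zero_add]
      rcases hv with rfl | hv
      · rw [add_zero]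
        exact Or.inr hu
      exact Or.inr ((ConvexCone.hull ℝ S).add_mem hu hv)
    | smul r u _ hu =>
      change (r : ℝ) • u ∈ _
      rcases hu with rfl | hu
      · exact Or.inl (smul_zero _)
      rcases r.2.eq_or_lt with h | h
      · exact Or.inl (by simp [← h])
      · exact Or.inr ((ConvexCone.hull ℝ S).smul_mem h hu)

/-- In a closed cone the direction of a line is a recession direction, so that it is enough to
exclude lines through the origin. -/
theorem containsNoLines_of_isClosed (hC : IsClosed (C : Set V))
    (hs : ∀ v ∈ C, -v ∈ C → v = 0) : ContainsNoLines (C : Set V) := by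
  intro p v hv h
  have key : ∀ w : V, (∀ t : ℝ, 0 ≤ t → p + t • w ∈ C) → w ∈ C := by
    intro w hw
    have hlim : Tendsto (fun n : ℕ => (n : ℝ)⁻¹ • p + w) atTop (𝓝 ((0 : ℝ) • p + w)) :=
      ((tendsto_inv_atTop_nhds_zero_nat (𝕜 := ℝ)).smul_const p).add_const w
    rw [zero_smul, zero_add] at hlim
    refine hC.mem_of_tendsto hlim ((eventually_gt_atTop 0).mono fun n hn => ?_)
    have hn' : (n : ℝ) ≠ 0 := Nat.cast_ne_zero.2 hn.ne'
    have := C.smul_mem (r := (n : ℝ)⁻¹) (by positivity) (hw n (Nat.cast_nonneg n))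
    rwa [smul_add, inv_smul_smul₀ hn'] at this
  exact hv (hs v (key v fun t _ => h t) (key (-v) fun t _ => by simpa using h (-t)))

end Cones

open scoped InnerProductSpace

section Epigraph

/-! ### The epigraphs of the augmented support function -/

variable {n : ℕ} {X : Set (EuclideanSpace ℝ (Fin n))} {A : Finset (EuclideanSpace ℝ (Fin n))}

theorem applyOp_add (ν μ : A → ℝ) : applyOp A (ν + μ) = applyOp A ν + applyOp A μ := by
  simp [applyOp, add_smul, Finset.sum_add_distrib]

theorem applyOp_smul (r : ℝ) (ν : A → ℝ) : applyOp A (r • ν) = r • applyOp A ν := by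
  simp [applyOp, mul_smul, Finset.smul_sum]

theorem continuous_applyOp : Continuous (applyOp A) := by
  unfold applyOp
  fun_prop

/-- The epigraph of `ν ↦ σ_X(-𝒜 ν)` over the cone `N_β`. The inequality
`σ_X(-𝒜 ν) ≤ t` is written pointwise on `X`, which avoids extended reals. -/
def epigraph (X : Set (EuclideanSpace ℝ (Fin n))) (A : Finset (EuclideanSpace ℝ (Fin n)))
    (β : A) : PointedCone ℝ ((A → ℝ) × ℝ) where
  carrier := {p | p.1 ∈ coneN A β ∧ ∀ x ∈ X, ⟪-applyOp A p.1, x⟫_ℝ ≤ p.2}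
  zero_mem' := ⟨⟨fun _ _ => le_rfl, by simp⟩, by simp [applyOp]⟩
  add_mem' := by
    rintro p q ⟨⟨hp, hp0⟩, hpx⟩ ⟨⟨hq, hq0⟩, hqx⟩
    refine ⟨⟨fun α h => add_nonneg (hp α h) (hq α h), ?_⟩, fun x hx => ?_⟩
    · change ∑ α, (p.1 α + q.1 α) = 0
      rw [Finset.sum_add_distrib, hp0, hq0, add_zero]
    · have := add_le_add (hpx x hx) (hqx x hx)
      rwa [← inner_add_left, ← neg_add, ← applyOp_add] at this
  smul_mem' := by
    rintro ⟨r, hr⟩ p ⟨⟨hp, hp0⟩, hpx⟩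
    refine ⟨⟨fun α h => mul_nonneg hr (hp α h), ?_⟩, fun x hx => ?_⟩
    · change ∑ α, r * p.1 α = 0
      rw [← Finset.mul_sum, hp0, mul_zero]
    · have := mul_le_mul_of_nonneg_left (hpx x hx) hr
      rwa [← real_inner_smul_left, smul_neg, ← applyOp_smul] at this

theorem mem_epigraph {β : A} {p : (A → ℝ) × ℝ} :
    p ∈ epigraph X A β ↔ p.1 ∈ coneN A β ∧ ∀ x ∈ X, ⟪-applyOp A p.1, x⟫_ℝ ≤ p.2 := Iff.rfl

theorem augSupport_le_iff {ν : A → ℝ} {t : ℝ} :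
    augSupport X A ν ≤ t ↔ ∀ x ∈ X, ⟪-applyOp A ν, x⟫_ℝ ≤ t := by
  simp only [augSupport, supportFn, iSup_le_iff, EReal.coe_le_coe_iff]

/-- For `X = ∅` the support function would take the value `-∞`. -/
theorem bot_lt_augSupport (hX : X.Nonempty) (ν : A → ℝ) : ⊥ < augSupport X A ν := by
  obtain ⟨x, hx⟩ := hX
  exact (EReal.bot_lt_coe _).trans_le
    (le_iSup₂ (f := fun x (_ : x ∈ X) => ((⟪-applyOp A ν, x⟫_ℝ : ℝ) : EReal)) x hx)

theorem coe_toReal_augSupport (hX : X.Nonempty) {ν : A → ℝ} (h : augSupport X A ν < ⊤) :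
    ((augSupport X A ν).toReal : EReal) = augSupport X A ν :=
  EReal.coe_toReal h.ne (bot_lt_augSupport hX ν).ne'

theorem functionalForm_mem_epigraph (hX : X.Nonempty) {β : A} {ν : A → ℝ} (hν : ν ∈ coneN A β)
    (h : augSupport X A ν < ⊤) : functionalForm X A ν ∈ epigraph X A β :=
  ⟨hν, augSupport_le_iff.1 (coe_toReal_augSupport hX h).ge⟩

theorem zero_one_mem_epigraph (β : A) : ((0, 1) : (A → ℝ) × ℝ) ∈ epigraph X A β :=
  ⟨⟨fun _ _ => le_rfl, by simp⟩, by simp [applyOp]⟩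

theorem augSupport_lt_top_of_mem {β : A} {p : (A → ℝ) × ℝ} (hp : p ∈ epigraph X A β) :
    augSupport X A p.1 < ⊤ :=
  (augSupport_le_iff.2 hp.2).trans_lt (EReal.coe_lt_top _)

theorem toReal_augSupport_le (hX : X.Nonempty) {β : A} {p : (A → ℝ) × ℝ}
    (hp : p ∈ epigraph X A β) : (augSupport X A p.1).toReal ≤ p.2 := by
  rw [← EReal.coe_le_coe_iff, coe_toReal_augSupport hX (augSupport_lt_top_of_mem hp)]
  exact augSupport_le_iff.2 hp.2

/-- Only the `β`-entry of a vector of `N_β` can be negative, so that `N_β` contains no lines. -/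
theorem coneN_eq_zero {β : A} {ν : A → ℝ} (hν : ν ∈ coneN A β) (h : 0 ≤ ν β) : ν = 0 := by
  have hnn : ∀ α, 0 ≤ ν α := fun α => by
    by_cases hα : α = β
    · exact hα ▸ h
    · exact hν.1 α hα
  ext α
  exact (Finset.sum_eq_zero_iff_of_nonneg fun α _ => hnn α).1 hν.2 α (Finset.mem_univ α)

theorem coneN_neg {β : A} {ν : A → ℝ} (hν : ν ∈ coneN A β) (h0 : ν ≠ 0) : ν β < 0 := by
  by_contra! h
  exact h0 (coneN_eq_zero hν h)

theorem isClosed_epigraph (β : A) : IsClosed (epigraph X A β : Set ((A → ℝ) × ℝ)) := by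
  have : (epigraph X A β : Set ((A → ℝ) × ℝ)) =
      ((⋂ α, ⋂ (_ : α ≠ β), {p | 0 ≤ p.1 α}) ∩ {p | ∑ α, p.1 α = 0}) ∩
        ⋂ x, ⋂ (_ : x ∈ X), {p | ⟪-applyOp A p.1, x⟫_ℝ ≤ p.2} := by
    ext p
    simp [mem_epigraph, coneN]
  rw [this]
  have hc := continuous_applyOp (A := A)
  refine ((isClosed_biInter fun α _ => ?_).inter ?_).inter (isClosed_biInter fun x _ => ?_)
  · exact isClosed_le continuous_const (by fun_prop)
  · exact isClosed_eq (by fun_prop) continuous_const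
  · exact isClosed_le (by fun_prop) (by fun_prop)

theorem epigraph_salient (hX : X.Nonempty) (β : A) :
    ∀ p ∈ epigraph X A β, -p ∈ epigraph X A β → p = 0 := by
  rintro ⟨ν, t⟩ hp hn
  have hν : ν = 0 := by
    by_contra h0
    have h1 := coneN_neg hp.1 h0
    have h2 := coneN_neg hn.1 (neg_ne_zero.2 h0)
    simp only [Prod.fst_neg, Pi.neg_apply] at h1 h2
    linarith
  subst hν
  obtain ⟨x, hx⟩ := hX
  have h1 := hp.2 x hx
  have h2 := hn.2 x hx
  simp [applyOp] at h1 h2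
  simp [le_antisymm h2 h1]

/-- Linearity of `ν ↦ σ_X(-𝒜 ν)` on a segment makes the functional form of an inner point a sum of
multiples of the functional forms of the end points, which extremeness forces to be
proportional. -/
theorem isCircuitAt_of_isExtremeVector (hX : X.Nonempty) {β : A} {ν : A → ℝ} (h0 : ν ≠ 0)
    (h : IsExtremeVector (epigraph X A β) (functionalForm X A ν)) : IsCircuitAt X A β ν := by
  obtain ⟨hmem, -, hext⟩ := h
  have hfin : augSupport X A (functionalForm X A ν).1 < ⊤ := augSupport_lt_top_of_mem hmem
  refine ⟨hmem.1, h0, hfin, ?_⟩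
  rintro ⟨ν₁, h₁, ν₂, h₂, hli, ⟨a, b, ha, hb, hab, hν⟩, hf₁, hf₂, hlin⟩
  have hm₁ := functionalForm_mem_epigraph hX h₁ hf₁
  have hm₂ := functionalForm_mem_epigraph hX h₂ hf₂
  have hsum : a • functionalForm X A ν₁ + b • functionalForm X A ν₂ = functionalForm X A ν := by
    have hval := hlin a b ha.le hb.le hab
    rw [hν, ← coe_toReal_augSupport hX hf₁, ← coe_toReal_augSupport hX hf₂, ← EReal.coe_mul,
      ← EReal.coe_mul, ← EReal.coe_add] at hval
    simp only [functionalForm, hval, EReal.toReal_coe, Prod.smul_mk, Prod.mk_add_mk, hν,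
      smul_eq_mul]
  obtain ⟨r, -, hr⟩ := hext _ (PointedCone.smul_mem _ ha.le hm₁) _
    (PointedCone.smul_mem _ hb.le hm₂) hsum
  have hr' : a • ν₁ = r • ν := by
    simpa only [Prod.smul_fst, functionalForm] using congrArg Prod.fst hr
  have hrel : (a - r * a) • ν₁ + (-(r * b)) • ν₂ = 0 := by
    rw [sub_smul, hr', ← hν]
    module
  obtain ⟨e₁, e₂⟩ := LinearIndependent.pair_iff.1 hli _ _ hrel
  have hr0 : r = 0 := (mul_eq_zero.1 (neg_eq_zero.1 e₂)).resolve_right hb.ne'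
  rw [hr0] at e₁
  linarith

/-- The extreme rays of the epigraph over `N_β` are spanned by `(0, 1)` and by functional forms of
normalized circuits. -/
theorem epigraph_extreme_cases (hX : X.Nonempty) {β : A} {p : (A → ℝ) × ℝ}
    (h : IsExtremeVector (epigraph X A β) p) :
    ∃ r : ℝ, 0 ≤ r ∧ ∃ g ∈ functionalForm X A '' normalizedCircuits X A ∪ {(0, 1)},
      p = r • g := by
  have hp := h.1
  by_cases hν : p.1 = 0
  · refine ⟨p.2, ?_, (0, 1), Or.inr rfl, Prod.ext (by simp [hν]) (by simp)⟩
    obtain ⟨x, hx⟩ := hX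
    simpa [hν, applyOp] using hp.2 x hx
  have hle := toReal_augSupport_le hX hp
  -- Extremeness puts `p` on the graph: otherwise a multiple of `(0, 1)` could be split off.
  have hff : p = functionalForm X A p.1 := by
    refine Prod.ext rfl ?_
    have hmem : ((0, p.2 - (augSupport X A p.1).toReal) : (A → ℝ) × ℝ) ∈ epigraph X A β := by
      simpa using PointedCone.smul_mem (epigraph X A β) (sub_nonneg.2 hle) (zero_one_mem_epigraph β)
    obtain ⟨r, -, hr⟩ := h.2.2 _ hmem (functionalForm X A p.1)
      (functionalForm_mem_epigraph hX hp.1 (augSupport_lt_top_of_mem hp))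
      (Prod.ext (by simp [functionalForm]) (by simp [functionalForm]))
    have h1 : (0 : A → ℝ) = r • p.1 := congrArg Prod.fst hr
    have h2 : p.2 - (augSupport X A p.1).toReal = r * p.2 := congrArg Prod.snd hr
    have hr0 : r = 0 := (smul_eq_zero.1 h1.symm).resolve_right hν
    rw [hr0, zero_mul] at h2
    exact sub_eq_zero.1 h2
  have hneg := coneN_neg hp.1 hν
  set c : ℝ := -p.1 β with hc
  have hcpos : 0 < c := by rw [hc]; linarith
  have hex := h.smul (inv_pos.2 hcpos)
  set q := c⁻¹ • p with hq
  have hq0 : q.1 ≠ 0 := smul_ne_zero (inv_pos.2 hcpos).ne' hν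
  have hqf : q = functionalForm X A q.1 := by
    refine Prod.ext rfl (le_antisymm ?_ (toReal_augSupport_le hX hex.1))
    have hm := functionalForm_mem_epigraph hX hex.1.1 (augSupport_lt_top_of_mem hex.1)
    have h2 := toReal_augSupport_le hX (PointedCone.smul_mem _ hcpos.le hm)
    have h3 : (c • functionalForm X A q.1).1 = p.1 := smul_inv_smul₀ hcpos.ne' p.1
    have h4 : p.2 = (augSupport X A p.1).toReal := congrArg Prod.snd hff
    rw [h3, ← h4] at h2
    exact (inv_mul_le_iff₀ hcpos).2 h2
  refine ⟨c, hcpos.le, q, Or.inl ⟨q.1, ⟨β, ?_, ?_⟩, hqf.symm⟩, (smul_inv_smul₀ hcpos.ne' p).symm⟩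
  · exact isCircuitAt_of_isExtremeVector hX hq0 (hqf ▸ hex)
  · change c⁻¹ * p.1 β = -1
    rw [hc, inv_neg, neg_mul, inv_mul_cancel₀ hneg.ne]

theorem norm_eq_one_of_normalized {ν : A → ℝ} (h : ν ∈ normalizedCircuits X A) : ‖ν‖ = 1 := by
  obtain ⟨β, hcirc, hβ⟩ := h
  obtain ⟨hnn, hsum⟩ := hcirc.1
  refine le_antisymm ((pi_norm_le_iff_of_nonneg zero_le_one).2 fun α => ?_) ?_
  · by_cases hα : α = β
    · simp [hα, hβ]
    · rw [Real.norm_of_nonneg (hnn α hα)]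
      rw [← Finset.add_sum_erase _ _ (Finset.mem_univ β), hβ] at hsum
      have := Finset.single_le_sum (f := ν) (fun γ hγ => hnn γ (Finset.ne_of_mem_erase hγ))
        (Finset.mem_erase.2 ⟨hα, Finset.mem_univ α⟩)
      linarith
  · simpa [hβ] using norm_le_pi_norm ν β

/-- The circuit graph is the Minkowski sum of the epigraphs over all `N_β`. -/
theorem hull_normalizedCircuits_eq_iSup (hX : X.Nonempty) (hA : A.Nonempty) :
    PointedCone.hull ℝ (functionalForm X A '' normalizedCircuits X A ∪ {(0, 1)}) =
      ⨆ β, epigraph X A β := by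
  refine le_antisymm (Submodule.span_le.2 ?_) (iSup_le fun β p hp => ?_)
  · rintro _ (⟨ν, ⟨β, hν, -⟩, rfl⟩ | rfl)
    · exact Submodule.mem_iSup_of_mem β (functionalForm_mem_epigraph hX hν.1 hν.2.2.1)
    · exact Submodule.mem_iSup_of_mem ⟨hA.choose, hA.choose_spec⟩ (zero_one_mem_epigraph _)
  · refine Submodule.span_le.2 ?_
      (mem_hull_isExtremeVector (isClosed_epigraph β) (epigraph_salient hX β) hp)
    intro q hq
    obtain ⟨r, hr, g, hg, rfl⟩ := epigraph_extreme_cases hX hq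
    exact PointedCone.smul_mem _ hr (Submodule.subset_span hg)

/-- If `α - β` were constant on `X`, then `exp ⟪α, ·⟫` would be a multiple of `exp ⟪β, ·⟫` there. -/
theorem not_constant_of_linearIndependent
    (h_indep : LinearIndependent ℝ
      (fun (α : A) (x : X) =>
        Real.exp (inner ℝ (α : EuclideanSpace ℝ (Fin n)) (x : EuclideanSpace ℝ (Fin n)))))
    (hX : X.Nonempty) {α β : A} (h : α ≠ β) :
    ¬ ∀ x ∈ X, ∀ y ∈ X, ⟪(α : EuclideanSpace ℝ (Fin n)) - β, x - y⟫_ℝ = 0 := by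
  intro hconst
  obtain ⟨x₀, hx₀⟩ := hX
  have hinj : Function.Injective ![α, β] := by
    intro i j hij
    fin_cases i <;> fin_cases j <;> simp_all [eq_comm]
  have hpair := h_indep.comp ![α, β] hinj
  have hrel := Fintype.linearIndependent_iff.1 hpair
    ![1, -Real.exp ⟪(α : EuclideanSpace ℝ (Fin n)) - β, x₀⟫_ℝ] ?_ 0
  · simp at hrel
  · funext x
    have h0 := hconst x x.2 x₀ hx₀
    rw [inner_sub_right, sub_eq_zero] at h0
    simp only [Fin.sum_univ_two, Function.comp_apply, Matrix.cons_val_zero, Matrix.cons_val_one,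
      one_smul, neg_smul, Pi.add_apply, Pi.neg_apply, Pi.smul_apply, smul_eq_mul, Pi.zero_apply]
    rw [← h0, ← Real.exp_add, inner_sub_left, sub_add_cancel, add_neg_cancel]

/-- The epigraphs over the cones `N_β` are positively independent: elements `(ν_β, t_β)` with sum
zero all vanish. The inequalities `⟪-𝒜 ν_β, x⟫ ≤ t_β` add up to an equality, so all are equalities
and `𝒜 ν_β` is orthogonal to `X - X`. With the orthogonal projection `P` onto the span of `X - X`
this makes `∑ α, ν_β α * ‖P α‖²` equal to `∑ α, ν_β α * ‖P α - P β‖²`, a sum of nonnegative terms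
that are positive unless `ν_β α = 0`. Summed over `β` it is zero. -/
theorem eq_zero_of_sum_epigraph_eq_zero
    (hX : X.Nonempty)
    (hsep : ∀ α β : A, α ≠ β →
      ¬ ∀ x ∈ X, ∀ y ∈ X, ⟪(α : EuclideanSpace ℝ (Fin n)) - β, x - y⟫_ℝ = 0)
    {z : A → (A → ℝ) × ℝ} (hz : ∀ β, z β ∈ epigraph X A β) (hsum : ∑ β, z β = 0) : z = 0 := by
  set K := vectorSpan ℝ X
  set P := K.starProjection with hP
  have hsum1 : ∑ β, (z β).1 = 0 := by rw [← Prod.fst_sum, hsum]; rfl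
  have hsum2 : ∑ β, (z β).2 = 0 := by rw [← Prod.snd_sum, hsum]; rfl
  have hsumop : ∑ β, applyOp A (z β).1 = 0 := by
    have hmap : ∀ s : Finset A, applyOp A (∑ β ∈ s, (z β).1) = ∑ β ∈ s, applyOp A (z β).1 := by
      intro s
      induction s using Finset.cons_induction with
      | empty => simp [applyOp]
      | cons a s ha ih => rw [Finset.sum_cons, Finset.sum_cons, applyOp_add, ih]
    rw [← hmap, hsum1]
    simp [applyOp]
  have htight : ∀ x ∈ X, ∀ β, ⟪-applyOp A (z β).1, x⟫_ℝ = (z β).2 := by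
    intro x hx β
    refine (Finset.sum_eq_sum_iff_of_le fun β _ => (hz β).2 x hx).1 ?_ β (Finset.mem_univ β)
    rw [hsum2, ← sum_inner, Finset.sum_neg_distrib, hsumop]
    simp
  have hproj : ∀ β, P (applyOp A (z β).1) = 0 := by
    intro β
    rw [hP, Submodule.starProjection_apply_eq_zero_iff, Submodule.mem_orthogonal']
    intro u hu
    induction hu using Submodule.span_induction with
    | mem u h =>
      obtain ⟨x, hx, y, hy, rfl⟩ := h
      have h1 := htight x hx β
      have h2 := htight y hy β
      simp only [inner_neg_left] at h1 h2
      simp only [vsub_eq_sub, inner_sub_right]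
      linarith
    | zero => simp
    | add u v _ _ hu hv => rw [inner_add_right, hu, hv, add_zero]
    | smul r u _ hu => rw [real_inner_smul_right, hu, mul_zero]
  have hne : ∀ α β : A, α ≠ β → P α ≠ P β := by
    intro α β h heq
    refine hsep α β h fun x hx y hy => ?_
    have h0 : K.starProjection ((α : EuclideanSpace ℝ (Fin n)) - β) = 0 := by
      rw [map_sub, sub_eq_zero]
      exact heq
    rw [Submodule.starProjection_apply_eq_zero_iff, Submodule.mem_orthogonal'] at h0
    exact h0 _ (vsub_mem_vectorSpan ℝ hx hy)
  -- Expand the square and use `∑ α, ν_β α = 0` and `∑ α, ν_β α • P α = 0`.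
  have hid : ∀ β, ∑ α, (z β).1 α * ‖P α‖ ^ 2 = ∑ α, (z β).1 α * ‖P α - P β‖ ^ 2 := by
    intro β
    have hb : ∑ α, (z β).1 α • P α = 0 := by
      rw [← hproj β, applyOp, map_sum]
      simp_rw [map_smul]
    have hb' : ∑ α, (z β).1 α * ⟪P α, P β⟫_ℝ = 0 := by
      have := congrArg (fun v => ⟪v, P β⟫_ℝ) hb
      simpa [sum_inner, real_inner_smul_left] using this
    have hexp : ∀ α : A, (z β).1 α * ‖P α - P β‖ ^ 2 = (z β).1 α * ‖P α‖ ^ 2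
        - 2 * ((z β).1 α * ⟪P α, P β⟫_ℝ) + ‖P β‖ ^ 2 * (z β).1 α := fun α => by
      rw [norm_sub_sq_real]
      ring
    simp_rw [hexp]
    rw [Finset.sum_add_distrib, Finset.sum_sub_distrib, ← Finset.mul_sum, ← Finset.mul_sum, hb',
      (hz β).1.2]
    simp
  have hterm : ∀ β α, 0 ≤ (z β).1 α * ‖P α - P β‖ ^ 2 := by
    intro β α
    by_cases h : α = β
    · simp [h]
    · exact mul_nonneg ((hz β).1.1 α h) (by positivity)
  have htotal : ∑ β, ∑ α, (z β).1 α * ‖P α - P β‖ ^ 2 = 0 := by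
    simp_rw [← hid]
    rw [Finset.sum_comm]
    simp_rw [← Finset.sum_mul]
    refine Finset.sum_eq_zero fun α _ => ?_
    have := congrFun hsum1 α
    rw [Finset.sum_apply] at this
    rw [this]
    simp
  funext β
  have hν : (z β).1 = 0 := by
    have hβ := (Finset.sum_eq_zero_iff_of_nonneg fun β _ =>
      Finset.sum_nonneg fun α _ => hterm β α).1 htotal β (Finset.mem_univ β)
    have hoff : ∀ α, α ≠ β → (z β).1 α = 0 := by
      intro α h
      have := (Finset.sum_eq_zero_iff_of_nonneg fun α _ => hterm β α).1 hβ α (Finset.mem_univ α)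
      refine (mul_eq_zero.1 this).resolve_right ?_
      exact pow_ne_zero 2 (norm_ne_zero_iff.2 (sub_ne_zero.2 (hne α β h)))
    refine coneN_eq_zero (hz β).1 ?_
    have := (hz β).1.2
    rw [Finset.sum_eq_single β (fun α _ h => hoff α h) (by simp)] at this
    exact this.ge
  refine Prod.ext hν ?_
  obtain ⟨x, hx⟩ := hX
  have := htight x hx β
  rw [hν] at this
  simpa [applyOp, eq_comm] using this

end Epigraph
end SublinearCircuit

/-! ### Structure of the circuit graph -/

theorem theorem5p5 {n : ℕ}
    (X : Set (EuclideanSpace ℝ (Fin n)))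
    (hX_closed : IsClosed X) (hX_convex : Convex ℝ X) (hX_nonempty : X.Nonempty)
    (A : Finset (EuclideanSpace ℝ (Fin n))) (hA : A.Nonempty)
    (h_indep : LinearIndependent ℝ
      (fun (α : A) (x : X) =>
        Real.exp (inner ℝ (α : EuclideanSpace ℝ (Fin n)) (x : EuclideanSpace ℝ (Fin n))))) :
    IsClosed (circuitGraph X A) ∧
      ContainsNoLines (circuitGraph X A) ∧
      circuitGraph X A =
        conicHull (functionalForm X A '' reducedCircuits X A ∪ {(0, 1)}) := by
  have hindep : ∀ z : A → (A → ℝ) × ℝ, (∀ β, z β ∈ epigraph X A β) → ∑ β, z β = 0 → z = 0 :=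
    fun z hz hsum => eq_zero_of_sum_epigraph_eq_zero hX_nonempty
      (fun _ _ h => not_constant_of_linearIndependent h_indep hX_nonempty h) hz hsum
  set G := PointedCone.hull ℝ (functionalForm X A '' normalizedCircuits X A ∪ {(0, 1)})
  have hG : circuitGraph X A = (G : Set ((A → ℝ) × ℝ)) := conicHull_eq_hull _
  have hmem : ∀ p, p ∈ G ↔
      ∃ z : A → (A → ℝ) × ℝ, (∀ β, z β ∈ epigraph X A β) ∧ ∑ β, z β = p := by
    intro p
    rw [show G = ⨆ β, epigraph X A β from hull_normalizedCircuits_eq_iSup hX_nonempty hA]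
    refine ⟨fun h => ?_, ?_⟩
    · have h' : p ∈ ⨆ β ∈ (Finset.univ : Finset A), epigraph X A β := by simpa using h
      obtain ⟨μ, hμ⟩ := (Submodule.mem_iSup_finset_iff_exists_sum _ _).1 h'
      exact ⟨fun β => μ β, fun β => (μ β).2, hμ⟩
    · rintro ⟨z, hz, rfl⟩
      exact Submodule.sum_mem _ fun β _ => Submodule.mem_iSup_of_mem β (hz β)
  have hclosed : IsClosed (G : Set ((A → ℝ) × ℝ)) := by
    -- `G` is the image of the product of the epigraphs under summation, whose kernel meets that
    -- product only in the origin by positive independence.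
    let L : (A → (A → ℝ) × ℝ) →L[ℝ] (A → ℝ) × ℝ := ∑ β, ContinuousLinearMap.proj β
    have hL : ∀ z, L z = ∑ β, z β := fun z => by simp [L]
    have himage : (G : Set ((A → ℝ) × ℝ)) = L '' {z | ∀ β, z β ∈ epigraph X A β} := by
      ext p
      simp only [SetLike.mem_coe, hmem, Set.mem_image, Set.mem_ofPred_eq, hL]
    rw [himage]
    refine isClosed_image_of_ker_trivial ?_ ?_ L fun z hz h => hindep z hz (by rwa [← hL])
    · simp only [Set.ofPred_forall]
      exact isClosed_iInter fun β => (isClosed_epigraph β).preimage (continuous_apply β)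
    · exact fun r hr z hz β => PointedCone.smul_mem _ hr.le (hz β)
  have hsalient : ∀ v ∈ G, -v ∈ G → v = 0 := by
    intro v hv hnv
    obtain ⟨z, hz, rfl⟩ := (hmem v).1 hv
    obtain ⟨w, hw, hwz⟩ := (hmem _).1 hnv
    have h0 := hindep (z + w) (fun β => Submodule.add_mem _ (hz β) (hw β))
      (by simp only [Pi.add_apply, Finset.sum_add_distrib, hwz, add_neg_cancel])
    refine Finset.sum_eq_zero fun β _ => epigraph_salient hX_nonempty β _ (hz β) ?_
    have := congrFun h0 β
    rw [neg_eq_of_add_eq_zero_right this]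
    exact hw β
  refine ⟨hG ▸ hclosed, hG ▸ containsNoLines_of_isClosed hclosed hsalient, ?_⟩
  rw [conicHull_eq_hull, hG]
  refine Set.Subset.antisymm ?_ ?_
  · suffices h : {v | IsExtremeVector G v} ⊆ PointedCone.hull ℝ
        (functionalForm X A '' reducedCircuits X A ∪ {(0, 1)}) from
      fun p hp => Submodule.span_le.2 h (mem_hull_isExtremeVector hclosed hsalient hp)
    intro v hv
    have h0 : (0 : (A → ℝ) × ℝ) ∉ functionalForm X A '' normalizedCircuits X A ∪ {(0, 1)} := by
      rintro (⟨ν, ⟨β, hν, -⟩, h⟩ | h)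
      · exact hν.2.1 (congrArg Prod.fst h)
      · exact zero_ne_one (congrArg Prod.snd h)
    obtain ⟨g, hg, r, hr, rfl⟩ := hv.exists_generator h0
    -- An extreme generator of the form `φ_ν` is the functional form of a reduced circuit, since a
    -- normalized circuit has norm one.
    rw [← inv_smul_smul₀ hr.ne' v]
    refine PointedCone.smul_mem _ (inv_pos.2 hr).le (Submodule.subset_span ?_)
    rcases hg with ⟨ν, hν, hνv⟩ | hg
    · refine Or.inl ⟨ν, ⟨hν, ?_, ?_⟩, hνv⟩
      · rwa [norm_eq_one_of_normalized hν, inv_one, one_smul]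
      · rw [hνv, hG]
        exact (hv.smul hr).isEdgeGenerator hsalient
    · exact Or.inr hg
  · refine Submodule.span_mono (Set.union_subset_union_left _ (Set.image_mono ?_))
    exact fun ν hν => hν.1
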